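/- Fix a weight $\omega\ge 1$. For $\gamma>\omega$ let $\beta(r,n)=c_n r$ with $c_0=\gamma$ and $c_n=0$ for $n\ge 1$ (one-step finite-time controllability), and put $B_k(r)=\sum_{n=0}^{k-2}\beta(r,n)+\omega\,\beta(r,k-1)$ for $k\ge1$. For $N\ge 2$ and $1\le m\le N-1$ let $$\alpha_{N,m}^{\omega}=\inf\ \frac{\sum_{n=0}^{N-2}\lambda_n+\omega\lambda_{N-1}-\nu}{\sum_{n=0}^{m-1}\lambda_n},$$ the infimum being over all real $\lambda_0,\dots,\lambda_{N-1},\nu>0$ with $$\sum_{n=k}^{N-2}\lambda_n+\omega\lambda_{N-1}\le B_{N-k}(\lambda_k)\quad(k=0,\dots,N-2),$$ $$\nu\le\sum_{n=0}^{j-1}\lambda_{n+m}+B_{N-j}(\lambda_{j+m})\quad(j=0,\dots,N-m-1).$$ The infimum is over a non-empty set that is bounded below. The following hold. (1) For all $\gamma>\omega$ and $N\ge2$: $\alpha_{N,1}^{\omega}\ge0$ if and only if $$N\ge f(\gamma):=2+\frac{\ln(\gamma-\omega)}{\ln\gamma-\ln(\gamma-1)}.$$ Moreover $f(\gamma)\sim\gamma\ln\gamma$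 as $\gamma\to\infty$, and the minimal stabilizing horizon, i.e. the least $N\ge2$ with $\alpha_{N,1}^\omega\ge0$, exists for every $\gamma>\omega$ and is also $\sim\gamma\ln\gamma$. (2) For all $\gamma>\omega$ and $N\ge2$: $\alpha_{N,\lfloor N/2\rfloor}^{\omega}\ge0$ if and only if $$N\ge\frac{2\ln\left(\frac{2\gamma-\omega-1}{\gamma-1}\right)}{\ln\gamma-\ln(\gamma-1)}\ \text{ if } N \text{ is even},\qquad N\ge\frac{\ln\left(\frac{2\gamma-\omega}{\gamma}\right)+\ln\left(\frac{2\gamma-\omega}{\gamma-1}\right)}{\ln\gamma-\ln(\gamma-1)}\ \text{ if } N\text{ is odd}.$$ Both right-hand sides are $\sim 2\ln 2\cdot\gamma$ as $\gamma\to\infty$, and the least $N\ge2$ with $\alpha_{N,\lfloor N/2\rfloor}^\omega\ge0$ exists for every $\gamma>\omega$ and is $\sim2\ln2\cdot\gamma$. Here $\omega$ is fixed in all limits and $a(\gamma)\sim b(\gamma)$ means $a(\gamma)/b(\gamma)\to1$. -/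

import Mathlib

/-- The bound `B_N(r) = ∑_{n=0}^{N-2} β(r,n) + ω β(r,N-1)`, `N ≥ 1`, with terminal weight `ω`. -/
def horizonBound (ω : ℝ) (β : ℝ → ℕ → ℝ) (N : ℕ) (r : ℝ) : ℝ :=
  (∑ n ∈ Finset.range (N - 1), β r n) + ω * β r (N - 1)

/-- The constraints on `λ_0, …, λ_{N-1}, ν` in the optimization problem for the optimization
horizon `N` and the control horizon `m`. Only the values `lam n` with `n < N` matter. -/
structure IsFeasible (ω : ℝ) (β : ℝ → ℕ → ℝ) (N m : ℕ) (lam : ℕ → ℝ) (ν : ℝ) : Prop where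
  lam_pos : ∀ n, n < N → 0 < lam n
  nu_pos : 0 < ν
  /-- The inequalities for `k = 0, …, N - 2`. -/
  tail_le : ∀ k, k + 2 ≤ N →
    (∑ n ∈ Finset.Ico k (N - 1), lam n) + ω * lam (N - 1) ≤ horizonBound ω β (N - k) (lam k)
  /-- The inequalities for `j = 0, …, N - m - 1`. -/
  nu_le : ∀ j, j + m + 1 ≤ N →
    ν ≤ (∑ n ∈ Finset.range j, lam (n + m)) + horizonBound ω β (N - j) (lam (j + m))

/-- The values of the objective function at the feasible points. -/
def objectiveValues (ω : ℝ) (β : ℝ → ℕ → ℝ) (N m : ℕ) : Set ℝ :=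
  {a | ∃ (lam : ℕ → ℝ) (ν : ℝ), IsFeasible ω β N m lam ν ∧
    a = ((∑ n ∈ Finset.range (N - 1), lam n) + ω * lam (N - 1) - ν) /
      ∑ n ∈ Finset.range m, lam n}

/-- The performance bound `α_{N,m}^ω`, the optimal value of the optimization problem. -/
noncomputable def alphaBound (ω : ℝ) (β : ℝ → ℕ → ℝ) (N m : ℕ) : ℝ :=
  sInf (objectiveValues ω β N m)

/-- One-step finite-time controllability: `β(r,n) = c_n r` with `c_0 = γ`, `c_n = 0` for
`n ≥ 1`. -/
def oneStep (γ : ℝ) (r : ℝ) (n : ℕ) : ℝ := (if n = 0 then γ else 0) * r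

/-- The optimization horizons `N ≥ 2` with `α_{N,m}^ω ≥ 0` for one-step finite-time
controllability, where the control horizon is `m = m(N)`. -/
def stabilizingHorizons (ω γ : ℝ) (m : ℕ → ℕ) : Set ℕ :=
  {N | 2 ≤ N ∧ 0 ≤ alphaBound ω (oneStep γ) N (m N)}

/-- The minimal stabilizing horizon for the control horizons `m = m(N)`. -/
noncomputable def minimalHorizon (ω γ : ℝ) (m : ℕ → ℕ) : ℕ :=
  sInf (stabilizingHorizons ω γ m)

/-- The horizon bound for `m = 1`. -/
noncomputable def fOne (ω γ : ℝ) : ℝ :=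
  2 + Real.log (γ - ω) / (Real.log γ - Real.log (γ - 1))

/-- The horizon bound for `m = ⌊N/2⌋` and even `N`. -/
noncomputable def fEven (ω γ : ℝ) : ℝ :=
  2 * Real.log ((2 * γ - ω - 1) / (γ - 1)) / (Real.log γ - Real.log (γ - 1))

/-- The horizon bound for `m = ⌊N/2⌋` and odd `N`. -/
noncomputable def fOdd (ω γ : ℝ) : ℝ :=
  (Real.log ((2 * γ - ω) / γ) + Real.log ((2 * γ - ω) / (γ - 1))) /
    (Real.log γ - Real.log (γ - 1))

open Filter Topology

/-! Since `m ≥ 1`, the constraints involve only `B_K` with `K ≥ 2`, where `B_K(r) = γ r`. In terms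
of the weighted tail sums `T_k` and `ρ = (γ - 1)/γ`, the first family of constraints reads `T_{k+1}
≤ ρ T_k`, and the objective is `(T_0 - ν)/(T_0 - T_m)`. Its sign is that of `T_0 - ν`, so the
question is how large `ν` can be relative to `T_0`.

The second family is a recursion for the tails shifted by `ν - T_m`, closed at the end by `T_{N-1} =
ω λ_{N-1}`. It gives `ν (γ - (γ - ω) ρ^(N-1-m)) ≤ γ T_m` (`IsFeasible.nu_mul_le`), while `T_m ≤ ρ^m
T_0`. One feasible point attains both bounds (`isFeasible_optLam`), so nonnegativity is equivalent
to `γ ρ^m + (γ - ω) ρ^(N-1-m) ≤ γ` (`alphaBound_nonneg_iff`).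

For the two choices of `m` this becomes `c ρ^n ≤ 1`, and logarithms give the thresholds. The
asymptotics follow from `1/(ln γ - ln(γ - 1)) ∼ γ`, rounding to integers costing only a bounded
amount. -/

lemma horizonBound_oneStep (ω γ r : ℝ) {K : ℕ} (hK : 2 ≤ K) :
    horizonBound ω (oneStep γ) K r = γ * r := by
  obtain ⟨K, rfl⟩ := Nat.exists_eq_add_of_le hK
  simp [horizonBound, oneStep, show 2 + K - 1 = K + 1 by omega]

/-! ### Tail sums and the contraction rate -/

/-- The weighted tail sums `∑_{n=k}^{N-2} λ_n + ω λ_{N-1}`. -/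
def tailSum (ω : ℝ) (N : ℕ) (lam : ℕ → ℝ) (k : ℕ) : ℝ :=
  (∑ n ∈ Finset.Ico k (N - 1), lam n) + ω * lam (N - 1)

lemma tailSum_succ (ω : ℝ) {N : ℕ} (lam : ℕ → ℝ) {k : ℕ} (hk : k + 2 ≤ N) :
    tailSum ω N lam k = lam k + tailSum ω N lam (k + 1) := by
  rw [tailSum, tailSum, Finset.sum_eq_sum_Ico_succ_bot (by omega : k < N - 1)]
  ring

lemma tailSum_last (ω : ℝ) (N : ℕ) (lam : ℕ → ℝ) :
    tailSum ω N lam (N - 1) = ω * lam (N - 1) := by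
  simp [tailSum]

lemma sum_range_shift_eq_tailSum_sub (ω : ℝ) {N m j : ℕ} (lam : ℕ → ℝ) (h : j + m + 1 ≤ N) :
    ∑ n ∈ Finset.range j, lam (n + m) = tailSum ω N lam m - tailSum ω N lam (j + m) := by
  induction j with
  | zero => simp
  | succ j ih =>
    rw [Finset.sum_range_succ, ih (by omega), tailSum_succ ω lam (k := j + m) (by omega),
      show j + 1 + m = j + m + 1 by omega]
    ring

lemma sum_range_eq_tailSum_sub (ω : ℝ) {N m : ℕ} (lam : ℕ → ℝ) (h : m + 1 ≤ N) :
    ∑ n ∈ Finset.range m, lam n = tailSum ω N lam 0 - tailSum ω N lam m := by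
  simpa using sum_range_shift_eq_tailSum_sub ω (m := 0) (j := m) lam (by omega)

lemma tailSum_zero (ω : ℝ) (N : ℕ) (lam : ℕ → ℝ) :
    tailSum ω N lam 0 = (∑ n ∈ Finset.range (N - 1), lam n) + ω * lam (N - 1) := by
  simp [tailSum]

/-- The contraction rate of the tail sums under one-step finite-time controllability. -/
noncomputable def contractionRate (γ : ℝ) : ℝ := (γ - 1) / γ

lemma contractionRate_pos {γ : ℝ} (hγ : 1 < γ) : 0 < contractionRate γ :=
  div_pos (by linarith) (by linarith)

lemma contractionRate_lt_one {γ : ℝ} (hγ : 1 < γ) : contractionRate γ < 1 := by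
  rw [contractionRate, div_lt_one (by linarith)]
  linarith

lemma mul_contractionRate {γ : ℝ} (hγ : 1 < γ) : γ * contractionRate γ = γ - 1 := by
  have : γ ≠ 0 := by linarith
  rw [contractionRate]
  field_simp

/-! ### Bounds valid at every feasible point -/

section Feasible

variable {ω γ : ℝ} {N m : ℕ} {lam : ℕ → ℝ} {ν : ℝ}

lemma IsFeasible.tailSum_succ_le (h : IsFeasible ω (oneStep γ) N m lam ν) (hγ : 1 < γ) {k : ℕ}
    (hk : k + 2 ≤ N) :
    tailSum ω N lam (k + 1) ≤ contractionRate γ * tailSum ω N lam k := by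
  have h1 := h.tail_le k hk
  rw [horizonBound_oneStep ω γ _ (by omega)] at h1
  change tailSum ω N lam k ≤ _ at h1
  have h2 := tailSum_succ ω lam hk
  have h3 := mul_contractionRate hγ
  have h4 : γ * tailSum ω N lam (k + 1) ≤ γ * (contractionRate γ * tailSum ω N lam k) := by
    rw [← mul_assoc, h3]
    have h5 : lam k = tailSum ω N lam k - tailSum ω N lam (k + 1) := by linarith
    rw [h5] at h1
    linarith
  exact le_of_mul_le_mul_left h4 (by linarith)

lemma IsFeasible.tailSum_le_pow (h : IsFeasible ω (oneStep γ) N m lam ν) (hγ : 1 < γ) {k : ℕ}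
    (hk : k + 1 ≤ N) :
    tailSum ω N lam k ≤ contractionRate γ ^ k * tailSum ω N lam 0 := by
  induction k with
  | zero => simp
  | succ k ih =>
    calc tailSum ω N lam (k + 1) ≤ contractionRate γ * tailSum ω N lam k :=
          h.tailSum_succ_le hγ (by omega)
      _ ≤ contractionRate γ * (contractionRate γ ^ k * tailSum ω N lam 0) :=
          mul_le_mul_of_nonneg_left (ih (by omega)) (contractionRate_pos hγ).le
      _ = _ := by ring

lemma IsFeasible.nu_le_tailSum (h : IsFeasible ω (oneStep γ) N m lam ν) (hm : 1 ≤ m) {j : ℕ}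
    (hj : j + m + 1 ≤ N) :
    ν ≤ tailSum ω N lam m - tailSum ω N lam (j + m) + γ * lam (j + m) := by
  have h1 := h.nu_le j hj
  rwa [horizonBound_oneStep ω γ _ (by omega), sum_range_shift_eq_tailSum_sub ω lam hj] at h1

/-- With `x = ν - T_m`, each constraint on `ν` says `T_{j+m+1} + x ≤ ρ (T_{j+m} + x)`; this is the
iterated form. -/
lemma IsFeasible.tailSum_add_le (h : IsFeasible ω (oneStep γ) N m lam ν) (hγ : 1 < γ)
    (hm : 1 ≤ m) {j : ℕ} (hj : j + m + 1 ≤ N) :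
    tailSum ω N lam (j + m) ≤ contractionRate γ ^ j * tailSum ω N lam m -
      (ν - tailSum ω N lam m) * (1 - contractionRate γ ^ j) := by
  induction j with
  | zero => simp
  | succ j ih =>
    have h1 := h.nu_le_tailSum hm (j := j) (by omega)
    have h2 := tailSum_succ ω lam (k := j + m) (N := N) (by omega)
    have h3 := mul_contractionRate hγ
    have h4 : lam (j + m) = tailSum ω N lam (j + m) - tailSum ω N lam (j + m + 1) := by linarith
    rw [h4] at h1
    have h5 := mul_le_mul_of_nonneg_left (ih (by omega)) (contractionRate_pos hγ).le
    have h6 : tailSum ω N lam (j + m + 1) ≤ contractionRate γ * tailSum ω N lam (j + m) -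
        (ν - tailSum ω N lam m) * (1 - contractionRate γ) := by
      refine le_of_mul_le_mul_left ?_ (by linarith : 0 < γ)
      calc γ * tailSum ω N lam (j + m + 1)
          ≤ (γ - 1) * tailSum ω N lam (j + m) - (ν - tailSum ω N lam m) * (γ - (γ - 1)) := by
            linarith
        _ = _ := by rw [← h3]; ring
    rw [show j + 1 + m = j + m + 1 by omega, pow_succ]
    linarith

lemma IsFeasible.nu_mul_le (h : IsFeasible ω (oneStep γ) N m lam ν) (hω : 1 ≤ ω) (hγ : ω < γ)
    (hm : 1 ≤ m) (hN : m + 1 ≤ N) :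
    ν * (γ - (γ - ω) * contractionRate γ ^ (N - 1 - m)) ≤ γ * tailSum ω N lam m := by
  have h1 := h.nu_le_tailSum hm (j := N - 1 - m) (by omega)
  have h2 := h.tailSum_add_le (by linarith) hm (j := N - 1 - m) (by omega)
  -- At the last index `ω λ_{N-1} = T_{N-1}`, so the constraint bounds `T_{N-1}` from below and the
  -- recursion bounds it from above. Weights `ω` and `γ - ω` eliminate it.
  rw [show N - 1 - m + m = N - 1 by omega] at h1 h2
  have h3 := tailSum_last ω N lam
  have h4 := mul_le_mul_of_nonneg_left h1 (by linarith : 0 ≤ ω)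
  have h5 := mul_le_mul_of_nonneg_left h2 (by linarith : 0 ≤ γ - ω)
  have h6 : ω * (γ * lam (N - 1)) = γ * tailSum ω N lam (N - 1) := by rw [h3]; ring
  nlinarith only [h4, h5, h6]

lemma IsFeasible.tailSum_pos (h : IsFeasible ω (oneStep γ) N m lam ν) (hω : 1 ≤ ω) {k : ℕ}
    (hN : 1 ≤ N) : 0 < tailSum ω N lam k := by
  have h1 : 0 < lam (N - 1) := h.lam_pos _ (by omega)
  have h2 : 0 ≤ ∑ n ∈ Finset.Ico k (N - 1), lam n :=
    Finset.sum_nonneg fun n hn => (h.lam_pos n (by have := Finset.mem_Ico.1 hn; omega)).le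
  rw [tailSum]
  have : 0 < ω * lam (N - 1) := by positivity
  linarith

end Feasible

/-! ### The extremal point -/

/-- The maximal relative excess of `ν` over the tail sum at `m`, where `M = N - 1 - m`. -/
noncomputable def excess (ω γ : ℝ) (M : ℕ) : ℝ :=
  (γ - ω) * contractionRate γ ^ M / (γ - (γ - ω) * contractionRate γ ^ M)

lemma excess_denom_pos {ω γ : ℝ} (hω : 1 ≤ ω) (hγ : ω < γ) (M : ℕ) :
    0 < γ - (γ - ω) * contractionRate γ ^ M := by
  have h1 := pow_le_one₀ (n := M) (contractionRate_pos (hω.trans_lt hγ)).le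
    (contractionRate_lt_one (hω.trans_lt hγ)).le
  have h2 := mul_le_mul_of_nonneg_left h1 (by linarith : 0 ≤ γ - ω)
  linarith

lemma excess_pos {ω γ : ℝ} (hω : 1 ≤ ω) (hγ : ω < γ) (M : ℕ) : 0 < excess ω γ M :=
  div_pos (mul_pos (by linarith) (pow_pos (contractionRate_pos (hω.trans_lt hγ)) _))
    (excess_denom_pos hω hγ M)

lemma excess_mul {ω γ : ℝ} (hω : 1 ≤ ω) (hγ : ω < γ) (M : ℕ) :
    excess ω γ M * (γ - (γ - ω) * contractionRate γ ^ M) = (γ - ω) * contractionRate γ ^ M :=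
  div_mul_cancel₀ _ (excess_denom_pos hω hγ M).ne'

/-- The tail sums of the optimal point, normalized to `1` at `0`. -/
noncomputable def optTail (ω γ : ℝ) (N m k : ℕ) : ℝ :=
  contractionRate γ ^ k - excess ω γ (N - 1 - m) *
    (contractionRate γ ^ m - contractionRate γ ^ max m k)

/-- The optimal values of `λ_0, …, λ_{N-1}`. -/
noncomputable def optLam (ω γ : ℝ) (N m n : ℕ) : ℝ :=
  if n = N - 1 then optTail ω γ N m (N - 1) / ω else optTail ω γ N m n - optTail ω γ N m (n + 1)

section Optimal

variable {ω γ : ℝ} {N m : ℕ}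

lemma tailSum_optLam (hω : 1 ≤ ω) {k : ℕ} (hk : k + 1 ≤ N) :
    tailSum ω N (optLam ω γ N m) k = optTail ω γ N m k := by
  have hω0 : ω ≠ 0 := by linarith
  obtain ⟨d, hd⟩ := Nat.exists_eq_add_of_le hk
  induction d generalizing k with
  | zero =>
    obtain rfl : k = N - 1 := by omega
    rw [tailSum_last, optLam, if_pos rfl]
    field_simp
  | succ d ih =>
    rw [tailSum_succ _ _ (by omega), ih (k := k + 1) (by omega) (by omega), optLam,
      if_neg (by omega)]
    ring

lemma mul_optLam (hγ : 1 < γ) {k : ℕ} (hk : k + 2 ≤ N) :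
    γ * optLam ω γ N m k =
      if k < m then contractionRate γ ^ k
      else contractionRate γ ^ k * (1 + excess ω γ (N - 1 - m)) := by
  have h := mul_contractionRate hγ
  rw [optLam, if_neg (by omega), optTail, optTail]
  split_ifs with hkm
  · rw [max_eq_left (by omega), max_eq_left (by omega), pow_succ]
    linear_combination (-contractionRate γ ^ k) * h
  · rw [max_eq_right (by omega), max_eq_right (by omega), pow_succ]
    linear_combination (-contractionRate γ ^ k * (1 + excess ω γ (N - 1 - m))) * h

/-- This is equality in the last constraint on `ν`, the condition that determines `excess`. -/
lemma mul_optTail_last (hω : 1 ≤ ω) (hγ : ω < γ) (hN : m + 1 ≤ N) :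
    (γ - ω) * optTail ω γ N m (N - 1) =
      ω * (contractionRate γ ^ m * excess ω γ (N - 1 - m)) := by
  have h := excess_mul hω hγ (N - 1 - m)
  rw [optTail, max_eq_right (by omega)]
  have h2 : contractionRate γ ^ (N - 1) =
      contractionRate γ ^ m * contractionRate γ ^ (N - 1 - m) := by
    rw [← pow_add]; congr 1; omega
  rw [h2]
  linear_combination (-contractionRate γ ^ m) * h

/-- The tail constraints are tight for `k < m` and every constraint on `ν` is tight; the tail
constraints with `k ≥ m` hold because `excess` is positive. -/
lemma isFeasible_optLam (hω : 1 ≤ ω) (hγ : ω < γ) (hm : 1 ≤ m) (hN : m + 1 ≤ N) :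
    IsFeasible ω (oneStep γ) N m (optLam ω γ N m)
      (contractionRate γ ^ m * (1 + excess ω γ (N - 1 - m))) := by
  have hγ1 : 1 < γ := hω.trans_lt hγ
  have hρ := contractionRate_pos hγ1
  have he := excess_pos hω hγ (N - 1 - m)
  have hlast := mul_optTail_last hω hγ hN
  refine ⟨fun n hn => ?_, by positivity, fun k hk => ?_, fun j hj => ?_⟩
  · rcases Nat.lt_or_ge (n + 1) N with h | h
    · have h1 := mul_optLam (ω := ω) (m := m) hγ1 (k := n) (N := N) (by omega)
      refine pos_of_mul_pos_right (a := γ) ?_ (by linarith)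
      rw [h1]
      split_ifs <;> positivity
    · rw [optLam, if_pos (by omega)]
      refine div_pos (pos_of_mul_pos_right (a := γ - ω) ?_ (by linarith)) (by linarith)
      rw [hlast]
      positivity
  · change tailSum ω N _ k ≤ _
    rw [tailSum_optLam hω (by omega), horizonBound_oneStep _ _ _ (by omega), mul_optLam hγ1 hk,
      optTail]
    split_ifs with hkm
    · rw [max_eq_left (by omega)]
      simp
    · rw [max_eq_right (by omega)]
      have : 0 < excess ω γ (N - 1 - m) * contractionRate γ ^ m := by positivity
      linarith
  · rw [horizonBound_oneStep _ _ _ (by omega), sum_range_shift_eq_tailSum_sub ω _ hj,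
      tailSum_optLam hω (by omega), tailSum_optLam hω (by omega)]
    rcases Nat.lt_or_ge (j + m + 1) N with h | h
    · rw [mul_optLam hγ1 (by omega), if_neg (by omega), optTail, optTail,
        max_self, max_eq_right (by omega)]
      linarith
    · have hω0 : ω ≠ 0 := by linarith
      rw [show j + m = N - 1 by omega, optLam, if_pos rfl]
      have h1 : γ * (optTail ω γ N m (N - 1) / ω) - optTail ω γ N m (N - 1) =
          contractionRate γ ^ m * excess ω γ (N - 1 - m) := by
        field_simp
        linarith
      have h2 : optTail ω γ N m m = contractionRate γ ^ m := by simp [optTail]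
      linarith

end Optimal

/-! ### Sign of the performance bound -/

section Alpha

variable {ω γ : ℝ} {N m : ℕ}

lemma objectiveValues_nonempty (hω : 1 ≤ ω) (hγ : ω < γ) (hm : 1 ≤ m) (hN : m + 1 ≤ N) :
    (objectiveValues ω (oneStep γ) N m).Nonempty :=
  ⟨_, _, _, isFeasible_optLam hω hγ hm hN, rfl⟩

lemma objectiveValues_bddBelow (hω : 1 ≤ ω) (hγ : ω < γ) (hm : 1 ≤ m) (hN : m + 1 ≤ N) :
    BddBelow (objectiveValues ω (oneStep γ) N m) := by
  have hγ1 : 1 < γ := hω.trans_lt hγ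
  have hd := excess_denom_pos hω hγ (N - 1 - m)
  set d := γ - (γ - ω) * contractionRate γ ^ (N - 1 - m) with hd_def
  -- Drop `T_0 > 0` from the numerator and use `ν ≤ (γ/d) T_0` and `T_0 - T_m ≥ (1 - ρ^m) T_0`.
  refine ⟨-(γ / d / (1 - contractionRate γ ^ m)), ?_⟩
  rintro _ ⟨lam, ν, h, rfl⟩
  have h0 := h.tailSum_pos hω (k := 0) (by omega)
  have h1 := h.nu_mul_le hω hγ hm hN
  have h2 := h.tailSum_le_pow hγ1 hN
  have h3 := pow_lt_one₀ (contractionRate_pos hγ1).le (contractionRate_lt_one hγ1)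
    (by omega : m ≠ 0)
  have h4 : tailSum ω N lam m ≤ tailSum ω N lam 0 := by nlinarith
  have h5 : 0 < 1 - contractionRate γ ^ m := by linarith
  have h6 : 0 < tailSum ω N lam 0 - tailSum ω N lam m := by nlinarith
  rw [← tailSum_zero, sum_range_eq_tailSum_sub ω lam hN, le_div_iff₀ h6]
  have h7 : ν ≤ γ / d * tailSum ω N lam 0 := by
    rw [div_mul_eq_mul_div, le_div_iff₀ hd]
    exact h1.trans (mul_le_mul_of_nonneg_left h4 (by linarith))
  have h8 : γ / d * tailSum ω N lam 0 ≤
      γ / d / (1 - contractionRate γ ^ m) * (tailSum ω N lam 0 - tailSum ω N lam m) := by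
    rw [div_mul_eq_mul_div (γ / d), le_div_iff₀ h5, mul_assoc]
    exact mul_le_mul_of_nonneg_left (by linarith) (div_pos (by linarith) hd).le
  linarith

/-- Nonnegativity of the performance bound as an inequality between powers. -/
lemma alphaBound_nonneg_iff (hω : 1 ≤ ω) (hγ : ω < γ) (hm : 1 ≤ m) (hN : m + 1 ≤ N) :
    0 ≤ alphaBound ω (oneStep γ) N m ↔
      γ * contractionRate γ ^ m + (γ - ω) * contractionRate γ ^ (N - 1 - m) ≤ γ := by
  have hγ1 : 1 < γ := hω.trans_lt hγ
  have hd := excess_denom_pos hω hγ (N - 1 - m)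
  have he := excess_mul hω hγ (N - 1 - m)
  have hρm := pow_lt_one₀ (contractionRate_pos hγ1).le (contractionRate_lt_one hγ1)
    (by omega : m ≠ 0)
  -- Nonemptiness and boundedness ensure that `sInf` is the true infimum and not the default value
  -- `0`.
  rw [alphaBound, le_csInf_iff (objectiveValues_bddBelow hω hγ hm hN)
    (objectiveValues_nonempty hω hγ hm hN)]
  constructor
  · intro h
    have h1 := h _ ⟨_, _, isFeasible_optLam hω hγ hm hN, rfl⟩
    rw [← tailSum_zero, sum_range_eq_tailSum_sub ω _ hN, tailSum_optLam hω (by omega),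
      tailSum_optLam hω hN] at h1
    have h2 : optTail ω γ N m 0 = 1 := by simp [optTail]
    have h3 : optTail ω γ N m m = contractionRate γ ^ m := by simp [optTail]
    rw [h2, h3, le_div_iff₀ (by linarith), zero_mul] at h1
    have h4 := mul_nonneg h1 hd.le
    have h5 : contractionRate γ ^ m * (excess ω γ (N - 1 - m) *
        (γ - (γ - ω) * contractionRate γ ^ (N - 1 - m))) =
        contractionRate γ ^ m * ((γ - ω) * contractionRate γ ^ (N - 1 - m)) := by rw [he]
    linarith
  · rintro h _ ⟨lam, ν, hf, rfl⟩
    have h0 := hf.tailSum_pos hω (k := 0) (by omega)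
    have h1 := hf.nu_mul_le hω hγ hm hN
    have h2 := mul_le_mul_of_nonneg_left (hf.tailSum_le_pow hγ1 hN) (by linarith : 0 ≤ γ)
    have h3 := mul_le_mul_of_nonneg_right h h0.le
    rw [← tailSum_zero]
    refine div_nonneg (sub_nonneg.2 (le_of_mul_le_mul_right ?_ hd))
      (Finset.sum_nonneg fun n hn => (hf.lam_pos n ?_).le)
    · linarith
    · have := Finset.mem_range.1 hn
      omega

end Alpha

/-! ### Explicit thresholds and minimal horizons -/

section Horizon

variable {ω γ : ℝ} {N : ℕ}

lemma log_sub_log_pos (hγ : 1 < γ) : 0 < Real.log γ - Real.log (γ - 1) :=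
  sub_pos.2 (Real.log_lt_log (by linarith) (by linarith))

lemma log_contractionRate (hγ : 1 < γ) :
    Real.log (contractionRate γ) = -(Real.log γ - Real.log (γ - 1)) := by
  rw [contractionRate, Real.log_div (by linarith) (by linarith)]
  ring

lemma mul_contractionRate_pow_le_one_iff (hγ : 1 < γ) {c : ℝ} (hc : 0 < c) (n : ℕ) :
    c * contractionRate γ ^ n ≤ 1 ↔ Real.log c / (Real.log γ - Real.log (γ - 1)) ≤ n := by
  have hρ := contractionRate_pos hγ
  rw [div_le_iff₀ (log_sub_log_pos hγ), ← Real.log_nonpos_iff (by positivity),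
    Real.log_mul hc.ne' (by positivity), Real.log_pow, log_contractionRate hγ]
  constructor <;> intro h <;> linarith

lemma alphaBound_one_nonneg_iff (hω : 1 ≤ ω) (hγ : ω < γ) (hN : 2 ≤ N) :
    0 ≤ alphaBound ω (oneStep γ) N 1 ↔ fOne ω γ ≤ N := by
  have hγ1 : 1 < γ := hω.trans_lt hγ
  obtain ⟨n, rfl⟩ := Nat.exists_eq_add_of_le hN
  have h1 := mul_contractionRate_pow_le_one_iff hγ1 (sub_pos.2 hγ) n
  rw [alphaBound_nonneg_iff hω hγ le_rfl hN, pow_one, mul_contractionRate hγ1,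
    show 2 + n - 1 - 1 = n by omega, fOne]
  push_cast
  rw [add_le_add_iff_left, ← h1]
  constructor <;> intro h <;> linarith

lemma alphaBound_half_nonneg_iff_of_even (hω : 1 ≤ ω) (hγ : ω < γ) (hN : 2 ≤ N)
    (he : Even N) : 0 ≤ alphaBound ω (oneStep γ) N (N / 2) ↔ fEven ω γ ≤ N := by
  have hγ1 : 1 < γ := hω.trans_lt hγ
  obtain ⟨m, rfl⟩ := he
  obtain ⟨n, rfl⟩ := Nat.exists_eq_add_of_le (by omega : 1 ≤ m)
  have hc : 0 < (2 * γ - ω - 1) / (γ - 1) := div_pos (by linarith) (by linarith)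
  have h1 := mul_contractionRate_pow_le_one_iff hγ1 hc (1 + n)
  have h2 := mul_contractionRate hγ1
  have h3 : fEven ω γ = 2 * (Real.log ((2 * γ - ω - 1) / (γ - 1)) /
      (Real.log γ - Real.log (γ - 1))) := by rw [fEven]; ring
  rw [alphaBound_nonneg_iff hω hγ (by omega) (by omega), h3,
    show (1 + n + (1 + n)) / 2 = 1 + n by omega, show 1 + n + (1 + n) - 1 - (1 + n) = n by omega]
  have h4 : ((1 + n + (1 + n) : ℕ) : ℝ) = 2 * ((1 + n : ℕ) : ℝ) := by push_cast; ring
  rw [h4, mul_le_mul_iff_right₀ two_pos, ← h1, div_mul_eq_mul_div, div_le_one (by linarith)]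
  -- Here `N - 1 - m = m - 1`; the missing factor `ρ` is supplied by `γ ρ = γ - 1`.
  have h5 : (2 * γ - ω - 1) * contractionRate γ ^ (1 + n) * γ = (γ - 1) *
      (γ * contractionRate γ ^ (1 + n) + (γ - ω) * contractionRate γ ^ n) := by
    rw [pow_add, pow_one]
    linear_combination (γ - ω) * contractionRate γ ^ n * h2
  rw [← mul_le_mul_iff_right₀ (by linarith : 0 < γ - 1), ← h5,
    mul_le_mul_iff_left₀ (by linarith)]

lemma alphaBound_half_nonneg_iff_of_odd (hω : 1 ≤ ω) (hγ : ω < γ) (hN : 2 ≤ N)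
    (ho : Odd N) : 0 ≤ alphaBound ω (oneStep γ) N (N / 2) ↔ fOdd ω γ ≤ N := by
  have hγ1 : 1 < γ := hω.trans_lt hγ
  obtain ⟨m, rfl⟩ := ho
  have hc : 0 < (2 * γ - ω) / γ := div_pos (by linarith) (by linarith)
  have h1 := mul_contractionRate_pow_le_one_iff hγ1 hc m
  have hL := log_sub_log_pos hγ1
  -- The two logarithms in the numerator differ by exactly the denominator, which produces the `+
  -- 1`.
  have h3 : fOdd ω γ = 2 * (Real.log ((2 * γ - ω) / γ) /
      (Real.log γ - Real.log (γ - 1))) + 1 := by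
    rw [fOdd, Real.log_div (by linarith) (by linarith), Real.log_div (by linarith) (by linarith)]
    field_simp
    ring
  rw [alphaBound_nonneg_iff hω hγ (by omega) (by omega), h3, show (2 * m + 1) / 2 = m by omega,
    show 2 * m + 1 - 1 - m = m by omega]
  push_cast
  rw [add_le_add_iff_right, mul_le_mul_iff_right₀ two_pos, ← h1, div_mul_eq_mul_div,
    div_le_one (by linarith)]
  constructor <;> intro h <;> linarith

lemma stabilizingHorizons_one_nonempty (hω : 1 ≤ ω) (hγ : ω < γ) :
    (stabilizingHorizons ω γ (fun _ => 1)).Nonempty :=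
  ⟨max 2 ⌈fOne ω γ⌉₊, le_max_left _ _, (alphaBound_one_nonneg_iff hω hγ (le_max_left _ _)).2
    ((Nat.le_ceil _).trans (by exact_mod_cast le_max_right _ _))⟩

/-- An even horizon suffices for existence; the summand `1` secures `N ≥ 2`. -/
lemma two_mul_ceil_mem_stabilizingHorizons (hω : 1 ≤ ω) (hγ : ω < γ) :
    2 * (1 + ⌈fEven ω γ / 2⌉₊) ∈ stabilizingHorizons ω γ (fun N => N / 2) := by
  refine ⟨by omega, (alphaBound_half_nonneg_iff_of_even hω hγ (by omega) (even_two_mul _)).2 ?_⟩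
  have := Nat.le_ceil (fEven ω γ / 2)
  push_cast
  linarith

lemma fOne_le_minimalHorizon (hω : 1 ≤ ω) (hγ : ω < γ) :
    fOne ω γ ≤ minimalHorizon ω γ (fun _ => 1) :=
  have h := Nat.sInf_mem (stabilizingHorizons_one_nonempty hω hγ)
  (alphaBound_one_nonneg_iff hω hγ h.1).1 h.2

lemma minimalHorizon_one_le (hω : 1 ≤ ω) (hγ : ω < γ) (h2 : 2 ≤ fOne ω γ) :
    (minimalHorizon ω γ (fun _ => 1) : ℝ) ≤ fOne ω γ + 1 := by
  have h3 : 2 ≤ ⌈fOne ω γ⌉₊ := by exact_mod_cast h2.trans (Nat.le_ceil _)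
  have h4 : minimalHorizon ω γ (fun _ => 1) ≤ ⌈fOne ω γ⌉₊ :=
    Nat.sInf_le ⟨h3, (alphaBound_one_nonneg_iff hω hγ h3).2 (Nat.le_ceil _)⟩
  have h5 : (minimalHorizon ω γ (fun _ => 1) : ℝ) ≤ (⌈fOne ω γ⌉₊ : ℝ) := by exact_mod_cast h4
  exact h5.trans (Nat.ceil_lt_add_one (by linarith)).le

/-- The parity of the minimal horizon is unknown, so only the smaller threshold is a safe lower
bound. -/
lemma min_le_minimalHorizon_half (hω : 1 ≤ ω) (hγ : ω < γ) :
    min (fEven ω γ) (fOdd ω γ) ≤ minimalHorizon ω γ (fun N => N / 2) := by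
  have h : minimalHorizon ω γ (fun N => N / 2) ∈ stabilizingHorizons ω γ (fun N => N / 2) :=
    Nat.sInf_mem ⟨_, two_mul_ceil_mem_stabilizingHorizons hω hγ⟩
  rcases Nat.even_or_odd (minimalHorizon ω γ (fun N => N / 2)) with he | ho
  · exact (min_le_left _ _).trans ((alphaBound_half_nonneg_iff_of_even hω hγ h.1 he).1 h.2)
  · exact (min_le_right _ _).trans ((alphaBound_half_nonneg_iff_of_odd hω hγ h.1 ho).1 h.2)

lemma minimalHorizon_half_le (hω : 1 ≤ ω) (hγ : ω < γ) (h0 : 0 ≤ fEven ω γ) :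
    (minimalHorizon ω γ (fun N => N / 2) : ℝ) ≤ fEven ω γ + 4 := by
  have h4 : minimalHorizon ω γ (fun N => N / 2) ≤ 2 * (1 + ⌈fEven ω γ / 2⌉₊) :=
    Nat.sInf_le (two_mul_ceil_mem_stabilizingHorizons hω hγ)
  have h5 : (minimalHorizon ω γ (fun N => N / 2) : ℝ) ≤ 2 * (1 + (⌈fEven ω γ / 2⌉₊ : ℝ)) := by
    exact_mod_cast h4
  have := (Nat.ceil_lt_add_one (by linarith : 0 ≤ fEven ω γ / 2)).le
  linarith

end Horizon

/-! ### Asymptotics as `γ → ∞` -/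

section Asymptotic

/-- `1 / (ln γ - ln (γ - 1)) ∼ γ`. -/
lemma tendsto_inv_log_sub_log :
    Tendsto (fun γ : ℝ => (Real.log γ - Real.log (γ - 1))⁻¹ / γ) atTop (𝓝 1) := by
  have h0 : Tendsto (fun γ : ℝ => 1 - γ⁻¹) atTop (𝓝 1) := by
    simpa using (tendsto_const_nhds (x := (1 : ℝ))).sub tendsto_inv_atTop_zero
  -- Applying `ln x ≤ x - 1` to `γ/(γ - 1)` and to its inverse gives `1/γ ≤ ln γ - ln(γ - 1) ≤ 1/(γ
  -- - 1)`.
  refine tendsto_of_tendsto_of_tendsto_of_le_of_le' h0 tendsto_const_nhds ?_ ?_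
  all_goals
    filter_upwards [eventually_gt_atTop 1] with γ hγ
    have hL := log_sub_log_pos hγ
    have hγ0 : 0 < γ := by linarith
    have hγ1 : 0 < γ - 1 := by linarith
  · have h1 := Real.log_le_sub_one_of_pos (div_pos hγ0 hγ1)
    rw [Real.log_div hγ0.ne' hγ1.ne'] at h1
    have h2 : γ / (γ - 1) - 1 = (γ - 1)⁻¹ := by field_simp; ring
    rw [h2] at h1
    rw [le_div_iff₀ hγ0, sub_mul, inv_mul_cancel₀ hγ0.ne', one_mul]
    exact (le_inv_comm₀ hL hγ1).1 h1
  · have h1 := Real.log_le_sub_one_of_pos (div_pos hγ1 hγ0)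
    rw [Real.log_div hγ1.ne' hγ0.ne'] at h1
    have h2 : (γ - 1) / γ - 1 = -γ⁻¹ := by field_simp; ring
    rw [div_le_one hγ0]
    exact inv_le_of_inv_le₀ hγ0 (by linarith)

lemma tendsto_mul_add_div_mul_add {a b c d : ℝ} (hc : c ≠ 0) :
    Tendsto (fun γ : ℝ => (a * γ + b) / (c * γ + d)) atTop (𝓝 (a / c)) := by
  have h (x y : ℝ) : Tendsto (fun γ : ℝ => x + y * γ⁻¹) atTop (𝓝 x) := by
    simpa using (tendsto_const_nhds (x := x)).add
      ((tendsto_const_nhds (x := y)).mul tendsto_inv_atTop_zero)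
  refine ((h a b).div (h c d) hc).congr' ?_
  filter_upwards [eventually_gt_atTop 0] with γ hγ
  rw [Pi.div_apply, ← mul_div_mul_right _ _ hγ.ne']
  congr 1 <;> field_simp

lemma tendsto_log_sub_div_log (ω : ℝ) :
    Tendsto (fun γ : ℝ => Real.log (γ - ω) / Real.log γ) atTop (𝓝 1) := by
  have h1 : Tendsto (fun γ : ℝ => Real.log ((γ - ω) / γ)) atTop (𝓝 0) := by
    have := (tendsto_mul_add_div_mul_add (a := 1) (b := -ω) (c := 1) (d := 0) one_ne_zero).log
      (by norm_num)
    simpa [sub_eq_add_neg] using this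
  have h2 := (h1.div_atTop Real.tendsto_log_atTop).add_const 1
  rw [zero_add] at h2
  refine h2.congr' ?_
  filter_upwards [eventually_gt_atTop ω, eventually_gt_atTop 1] with γ h3 h4
  have h5 := Real.log_pos h4
  rw [Real.log_div (by linarith) (by linarith)]
  field_simp
  ring

lemma tendsto_fOne_div (ω : ℝ) :
    Tendsto (fun γ : ℝ => fOne ω γ / (γ * Real.log γ)) atTop (𝓝 1) := by
  have h1 : Tendsto (fun γ : ℝ => 2 / (γ * Real.log γ)) atTop (𝓝 0) :=
    tendsto_const_nhds.div_atTop (tendsto_id.atTop_mul_atTop₀ Real.tendsto_log_atTop)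
  have h2 := h1.add ((tendsto_log_sub_div_log ω).mul tendsto_inv_log_sub_log)
  rw [zero_add, one_mul] at h2
  refine h2.congr fun γ => ?_
  rw [fOne, add_div, div_mul_div_comm, mul_comm γ (Real.log γ), ← div_eq_mul_inv]

lemma tendsto_fEven_div (ω : ℝ) :
    Tendsto (fun γ : ℝ => fEven ω γ / (2 * Real.log 2 * γ)) atTop (𝓝 1) := by
  have h1 := (tendsto_mul_add_div_mul_add (a := 2) (b := -ω - 1) (c := 1) (d := -1)
    one_ne_zero).log (by norm_num)
  have h2 := (h1.div_const (Real.log 2)).mul tendsto_inv_log_sub_log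
  have h3 : Real.log 2 ≠ 0 := (Real.log_pos one_lt_two).ne'
  rw [div_one, div_self h3, one_mul] at h2
  refine h2.congr fun γ => ?_
  rw [fEven, show 2 * γ + (-ω - 1) = 2 * γ - ω - 1 by ring, show 1 * γ + -1 = γ - 1 by ring]
  rw [div_mul_div_comm, ← div_eq_mul_inv, mul_assoc 2, mul_div_assoc 2,
    mul_div_mul_left _ _ two_ne_zero]

lemma tendsto_fOdd_div (ω : ℝ) :
    Tendsto (fun γ : ℝ => fOdd ω γ / (2 * Real.log 2 * γ)) atTop (𝓝 1) := by
  have h1 := (tendsto_mul_add_div_mul_add (a := 2) (b := -ω) (c := 1) (d := 0)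
    one_ne_zero).log (by norm_num)
  have h1' := (tendsto_mul_add_div_mul_add (a := 2) (b := -ω) (c := 1) (d := -1)
    one_ne_zero).log (by norm_num)
  have h2 := ((h1.add h1').div_const (2 * Real.log 2)).mul tendsto_inv_log_sub_log
  have h3 : Real.log 2 ≠ 0 := (Real.log_pos one_lt_two).ne'
  rw [div_one, ← two_mul, div_self (mul_ne_zero two_ne_zero h3), one_mul] at h2
  refine h2.congr fun γ => ?_
  rw [fOdd, show 2 * γ + -ω = 2 * γ - ω by ring, show 1 * γ + -1 = γ - 1 by ring,
    show 1 * γ + 0 = γ by ring, div_mul_div_comm, ← div_eq_mul_inv]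

lemma tendsto_minimalHorizon_one_div {ω : ℝ} (hω : 1 ≤ ω) :
    Tendsto (fun γ : ℝ => (minimalHorizon ω γ (fun _ => 1) : ℝ) / (γ * Real.log γ)) atTop
      (𝓝 1) := by
  have h1 : Tendsto (fun γ : ℝ => 1 / (γ * Real.log γ)) atTop (𝓝 0) :=
    tendsto_const_nhds.div_atTop (tendsto_id.atTop_mul_atTop₀ Real.tendsto_log_atTop)
  have h2 := (tendsto_fOne_div ω).add h1
  rw [add_zero] at h2
  refine tendsto_of_tendsto_of_tendsto_of_le_of_le' (tendsto_fOne_div ω) h2 ?_ ?_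
  all_goals
    -- From `γ ≥ ω + 1` on, `ln(γ - ω) ≥ 0`, so `fOne ω γ ≥ 2` and the constraint `N ≥ 2` is
    -- harmless.
    filter_upwards [eventually_ge_atTop (ω + 1)] with γ hγ
    have hlog : 0 ≤ γ * Real.log γ :=
      mul_nonneg (by linarith) (Real.log_nonneg (by linarith))
  · exact div_le_div_of_nonneg_right (fOne_le_minimalHorizon hω (by linarith)) hlog
  · rw [← add_div]
    refine div_le_div_of_nonneg_right (minimalHorizon_one_le hω (by linarith) ?_) hlog
    rw [fOne, le_add_iff_nonneg_right]
    exact div_nonneg (Real.log_nonneg (by linarith)) (log_sub_log_pos (by linarith)).le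

lemma tendsto_minimalHorizon_half_div {ω : ℝ} (hω : 1 ≤ ω) :
    Tendsto (fun γ : ℝ => (minimalHorizon ω γ (fun N => N / 2) : ℝ) / (2 * Real.log 2 * γ))
      atTop (𝓝 1) := by
  have hlog := Real.log_pos one_lt_two
  have h1 : Tendsto (fun γ : ℝ => 4 / (2 * Real.log 2 * γ)) atTop (𝓝 0) :=
    tendsto_const_nhds.div_atTop (tendsto_id.const_mul_atTop (by positivity))
  have h2 := (tendsto_fEven_div ω).add h1
  have h3 := (tendsto_fEven_div ω).min (tendsto_fOdd_div ω)
  rw [add_zero] at h2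
  rw [min_self] at h3
  refine tendsto_of_tendsto_of_tendsto_of_le_of_le' h3 h2 ?_ ?_
  all_goals
    filter_upwards [eventually_ge_atTop (ω + 1)] with γ hγ
    have hpos : 0 ≤ 2 * Real.log 2 * γ := mul_nonneg (by positivity) (by linarith)
  · rw [min_div_div_right hpos]
    exact div_le_div_of_nonneg_right (min_le_minimalHorizon_half hω (by linarith)) hpos
  · rw [← add_div]
    refine div_le_div_of_nonneg_right (minimalHorizon_half_le hω (by linarith) ?_) hpos
    refine div_nonneg (mul_nonneg two_pos.le (Real.log_nonneg ?_))
      (log_sub_log_pos (by linarith)).le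
    rw [one_le_div (by linarith)]
    linarith

lemma eventually_mul_log_ne_zero : ∀ᶠ γ : ℝ in atTop, γ * Real.log γ ≠ 0 := by
  filter_upwards [eventually_gt_atTop 1] with γ hγ
  exact mul_ne_zero (by linarith) (Real.log_pos hγ).ne'

lemma eventually_two_mul_log_two_mul_ne_zero : ∀ᶠ γ : ℝ in atTop, 2 * Real.log 2 * γ ≠ 0 := by
  filter_upwards [eventually_gt_atTop 0] with γ hγ
  exact mul_ne_zero (mul_pos two_pos (Real.log_pos one_lt_two)).ne' hγ.ne'

end Asymptotic

theorem mainTheorem9 (ω : ℝ) (hω : 1 ≤ ω) :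
    -- the optimization problems are feasible and bounded below
    (∀ γ : ℝ, ω < γ → ∀ N m : ℕ, 1 ≤ m → m + 1 ≤ N →
      (objectiveValues ω (oneStep γ) N m).Nonempty ∧
        BddBelow (objectiveValues ω (oneStep γ) N m)) ∧
    -- control horizon `m = 1`
    (∀ γ : ℝ, ω < γ → ∀ N : ℕ, 2 ≤ N →
      (0 ≤ alphaBound ω (oneStep γ) N 1 ↔ fOne ω γ ≤ N)) ∧
    Asymptotics.IsEquivalent Filter.atTop (fun γ : ℝ => fOne ω γ)
      (fun γ : ℝ => γ * Real.log γ) ∧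
    (∀ γ : ℝ, ω < γ → (stabilizingHorizons ω γ (fun _ => 1)).Nonempty) ∧
    Asymptotics.IsEquivalent Filter.atTop
      (fun γ : ℝ => (minimalHorizon ω γ (fun _ => 1) : ℝ)) (fun γ : ℝ => γ * Real.log γ) ∧
    -- control horizon `m = ⌊N / 2⌋`
    (∀ γ : ℝ, ω < γ → ∀ N : ℕ, 2 ≤ N → Even N →
      (0 ≤ alphaBound ω (oneStep γ) N (N / 2) ↔ fEven ω γ ≤ N)) ∧
    (∀ γ : ℝ, ω < γ → ∀ N : ℕ, 2 ≤ N → Odd N →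
      (0 ≤ alphaBound ω (oneStep γ) N (N / 2) ↔ fOdd ω γ ≤ N)) ∧
    Asymptotics.IsEquivalent Filter.atTop (fun γ : ℝ => fEven ω γ)
      (fun γ : ℝ => 2 * Real.log 2 * γ) ∧
    Asymptotics.IsEquivalent Filter.atTop (fun γ : ℝ => fOdd ω γ)
      (fun γ : ℝ => 2 * Real.log 2 * γ) ∧
    (∀ γ : ℝ, ω < γ → (stabilizingHorizons ω γ (fun N => N / 2)).Nonempty) ∧
    Asymptotics.IsEquivalent Filter.atTop
      (fun γ : ℝ => (minimalHorizon ω γ (fun N => N / 2) : ℝ))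
      (fun γ : ℝ => 2 * Real.log 2 * γ) := by
  have h1 := eventually_mul_log_ne_zero
  have h2 := eventually_two_mul_log_two_mul_ne_zero
  exact ⟨fun γ hγ N m hm hN => ⟨objectiveValues_nonempty hω hγ hm hN,
      objectiveValues_bddBelow hω hγ hm hN⟩,
    fun γ hγ N hN => alphaBound_one_nonneg_iff hω hγ hN,
    (Asymptotics.isEquivalent_iff_tendsto_one h1).2 (tendsto_fOne_div ω),
    fun γ hγ => stabilizingHorizons_one_nonempty hω hγ,
    (Asymptotics.isEquivalent_iff_tendsto_one h1).2 (tendsto_minimalHorizon_one_div hω),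
    fun γ hγ N hN he => alphaBound_half_nonneg_iff_of_even hω hγ hN he,
    fun γ hγ N hN ho => alphaBound_half_nonneg_iff_of_odd hω hγ hN ho,
    (Asymptotics.isEquivalent_iff_tendsto_one h2).2 (tendsto_fEven_div ω),
    (Asymptotics.isEquivalent_iff_tendsto_one h2).2 (tendsto_fOdd_div ω),
    fun γ hγ => ⟨_, two_mul_ceil_mem_stabilizingHorizons hω hγ⟩,
    (Asymptotics.isEquivalent_iff_tendsto_one h2).2 (tendsto_minimalHorizon_half_div hω)⟩
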